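/- Let $A$ be a finite alphabet and let $\alpha$ be an infinite word over $A$. Then $\alpha$ is a morphic word with growth $O(n^2)$ if and only if $\alpha$ is multilinear. Here $\alpha$ is a morphic word with growth $O(n^2)$ if there are a finite alphabet $B$, a morphism $h : B^*\to B^*$, a coding (letter-to-letter map) $\tau : B\to A$, and a letter $c\in B$ such that: $h$ is prolongable on $c$, i.e. $h(c)=cx$ for some string $x\in B^*$ with $h^i(x)$ nonempty for all $i\ge 0$; $\alpha=\tau(h^\omega(c))$, where $h^\omega(c)=c\,x\,h(x)\,h^2(x)\cdots$; and $|h^n(c)|=O(n^2)$ as $n\to\infty$. The word $\alpha$ is multilinear if $$\alpha = q\prod_{n\ge 0} r_1^{a_1n+b_1}r_2^{a_2n+b_2}\cdots r_m^{a_mn+b_m}$$ (the product denoting concatenation) for some string $q$ (possibly empty), some positive integer $m$, nonempty strings $r_1,\dots,r_m$, and nonnegative integers $a_i,b_i$ with $a_i+b_i>0$ for $1\le i\le m$. -/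

import Mathlib

open Filter Asymptotics

namespace MorphicWords

/-- The string `x` is a prefix of the infinite word `α` (strings are elements of the free monoid,
infinite words over `A` are functions `ℕ → A`, with letters indexed from `0`). -/
def IsPrefixOf {A : Type*} (x : FreeMonoid A) (α : ℕ → A) : Prop :=
  ∀ i : ℕ, i < x.length → x.toList[i]? = some (α i)

/-- The finite concatenation `q (u 0) (u 1) ⋯ (u (n - 1))`. -/
def partialConcat {A : Type*} (q : FreeMonoid A) (u : ℕ → FreeMonoid A) (n : ℕ) : FreeMonoid A :=
  q * ((List.range n).map u).prod

/-- The infinite word `α` is the infinite concatenation `q (u 0) (u 1) (u 2) ⋯`: every finite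
concatenation is a prefix of `α`, and their lengths are unbounded (so the concatenation is an
infinite word, and `α` is determined by `q` and `u`). -/
def IsConcat {A : Type*} (q : FreeMonoid A) (u : ℕ → FreeMonoid A) (α : ℕ → A) : Prop :=
  (∀ n : ℕ, IsPrefixOf (partialConcat q u n) α) ∧
    Tendsto (fun n : ℕ => (partialConcat q u n).length) atTop atTop

/-- The infinite word `α` is multilinear: it has the form
`q ∏_{n ≥ 0} r₁^(a₁ n + b₁) ⋯ r_m^(a_m n + b_m)` with `m` positive, every `r_i` a nonempty string,
and `a_i`, `b_i` nonnegative integers with `a_i + b_i > 0`. -/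
def IsMultilinear {A : Type*} (α : ℕ → A) : Prop :=
  ∃ (q : FreeMonoid A) (m : ℕ) (r : Fin m → FreeMonoid A) (a b : Fin m → ℕ),
    0 < m ∧ (∀ i, r i ≠ 1) ∧ (∀ i, 0 < a i + b i) ∧
      IsConcat q (fun n : ℕ => (List.ofFn fun i : Fin m => r i ^ (a i * n + b i)).prod) α

/-- The string `x` is mortal for the morphism `h`. -/
def IsMortal {B : Type*} (h : FreeMonoid B →* FreeMonoid B) (x : FreeMonoid B) : Prop :=
  ∃ m : ℕ, h^[m] x = 1

/-- The morphism `h` is prolongable on the letter `c`: `h(c) = c x` with `x` not mortal. -/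
def IsProlongable {B : Type*} (h : FreeMonoid B →* FreeMonoid B) (c : B) : Prop :=
  ∃ x : FreeMonoid B, h (FreeMonoid.of c) = FreeMonoid.of c * x ∧ ¬ IsMortal h x

/-- The infinite word `β` is `h^ω(c) = c x h(x) h²(x) ⋯`, where `h(c) = c x`
(the string `x` is uniquely determined). -/
def IsOmegaIterate {B : Type*} (h : FreeMonoid B →* FreeMonoid B) (c : B) (β : ℕ → B) : Prop :=
  ∃ x : FreeMonoid B, h (FreeMonoid.of c) = FreeMonoid.of c * x ∧
    IsConcat (FreeMonoid.of c) (fun n : ℕ => h^[n] x) β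

/-- The infinite word `α` is a morphic word with growth `f`: there are a finite alphabet `B`, a
morphism `h` on `B`, a coding (letter-to-letter map) `τ`, and a letter `c`, such that `h` is
prolongable on `c`, `α = τ(h^ω(c))`, and `|h^n(c)| = f n` for all `n`. -/
def IsMorphicWithGrowth {A : Type*} (α : ℕ → A) (f : ℕ → ℕ) : Prop :=
  ∃ (B : Type) (_ : Finite B) (h : FreeMonoid B →* FreeMonoid B) (τ : B → A) (c : B),
    IsProlongable h c ∧
    (∃ β : ℕ → B, IsOmegaIterate h c β ∧ α = τ ∘ β) ∧
    ∀ n : ℕ, (h^[n] (FreeMonoid.of c)).length = f n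

end MorphicWords

/-!
The proof compares the lengths of the iterates `hⁿ(x)`, where `h(c) = c x`, with the number of
letters in them that are *unbounded*, meaning that their own iterates have unbounded length.

From morphic to multilinear: call a set `S` of letters *persistent* if every letter of `S` produces
a letter of `S` and no other letter does. The immortal letters and the unbounded letters are such
sets. Along the iterates on a word, the number of occurrences of a persistent set is either bounded
or at least linear (`Persistent.exists_bounded_or_linear`). Applied to immortal letters, this says
that an unbounded letter grows at least linearly. Applied to unbounded letters, it says that their
number in `hⁿ(x)` is bounded or at least linear, and the second case would give
`|hⁿ(c)|` cubic growth (`exists_length_proj_unbounded_le`). So the number is bounded, and there are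
finitely many possibilities both for the sequence of unbounded letters of `hⁿ(x)` and for the
iterates on the bounded letters. Hence some power `H` of `h` stabilizes both (`exists_period`):
`H² = H` on words of bounded letters, and in the relevant words every unbounded letter `b` satisfies
`H(b) = v b w` with `v`, `w` made of bounded letters. Then
`Hⁿ⁺¹(b) = H(v)ⁿ (v b w) H(w)ⁿ`, so that grouping the factors of
`h^ω(c)` according to `H` displays a multilinear word (`isMultilinear_of_quadratic`).

From multilinear to morphic: a power `(s t)^(a n + b + 1)`, with `s` a letter, is coded by the
`n`-th iterate on `g t (s t)^b`, where `g` is a letter coded by `s` with `h(g) = g (t s)^a` and all other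
letters are fixed. The prefix of the multilinear word becomes the starting letter followed by
letters that `h` erases (`exists_morphic_of_presentation`).
-/

namespace MorphicWords

/-! ### Infinite concatenations -/

section Concat

variable {A B : Type*}

lemma partialConcat_zero (q : FreeMonoid A) (u : ℕ → FreeMonoid A) :
    partialConcat q u 0 = q := by
  simp [partialConcat]

lemma partialConcat_succ (q : FreeMonoid A) (u : ℕ → FreeMonoid A) (n : ℕ) :
    partialConcat q u (n + 1) = partialConcat q u n * u n := by
  simp [partialConcat, List.range_succ, mul_assoc]

lemma partialConcat_map (τ : A → B) (q : FreeMonoid A) (u : ℕ → FreeMonoid A) (n : ℕ) :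
    partialConcat (FreeMonoid.map τ q) (fun k => FreeMonoid.map τ (u k)) n =
      FreeMonoid.map τ (partialConcat q u n) := by
  induction n with
  | zero => simp [partialConcat_zero]
  | succ n ih => simp [partialConcat_succ, ih]

lemma length_map (τ : A → B) (x : FreeMonoid A) : (FreeMonoid.map τ x).length = x.length := by
  simp [FreeMonoid.length, FreeMonoid.toList_map]

lemma IsConcat.map {q : FreeMonoid A} {u : ℕ → FreeMonoid A} {β : ℕ → A}
    (hβ : IsConcat q u β) (τ : A → B) :
    IsConcat (FreeMonoid.map τ q) (fun n => FreeMonoid.map τ (u n)) (τ ∘ β) := by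
  refine ⟨fun n i hi => ?_, ?_⟩
  · rw [partialConcat_map, length_map] at hi
    simp [partialConcat_map, FreeMonoid.toList_map, hβ.1 n i hi]
  · simpa only [partialConcat_map, length_map] using hβ.2

/-- Regrouping: a product whose partial concatenations are among those of another
product, cofinally, represents the same infinite word. -/
lemma IsConcat.of_subseq {q q' : FreeMonoid A} {u u' : ℕ → FreeMonoid A} {α : ℕ → A}
    (hα : IsConcat q u α) (φ : ℕ → ℕ) (hφ : Tendsto φ atTop atTop)
    (h : ∀ n, partialConcat q' u' n = partialConcat q u (φ n)) : IsConcat q' u' α := by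
  refine ⟨fun n => ?_, ?_⟩
  · rw [h]
    exact hα.1 _
  · simp only [h]
    exact hα.2.comp hφ

lemma IsConcat.shift {q : FreeMonoid A} {u : ℕ → FreeMonoid A} {α : ℕ → A}
    (hα : IsConcat q u α) (k : ℕ) :
    IsConcat (partialConcat q u k) (fun n => u (n + k)) α := by
  refine hα.of_subseq (· + k) (tendsto_add_atTop_nat k) fun n => ?_
  induction n with
  | zero => simp [partialConcat_zero]
  | succ n ih => rw [partialConcat_succ, ih, ← partialConcat_succ, add_right_comm]

lemma IsConcat.group {q : FreeMonoid A} {u : ℕ → FreeMonoid A} {α : ℕ → A}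
    (hα : IsConcat q u α) {p : ℕ} (hp : 0 < p) :
    IsConcat q (fun n => partialConcat 1 (fun j => u (p * n + j)) p) α := by
  refine hα.of_subseq (p * ·) (tendsto_id.const_mul_atTop' hp) fun n => ?_
  have aux : ∀ N j, partialConcat q u N * partialConcat 1 (fun j => u (N + j)) j =
      partialConcat q u (N + j) := by
    intro N j
    induction j with
    | zero => simp [partialConcat_zero]
    | succ j ih => rw [partialConcat_succ, ← mul_assoc, ih, ← add_assoc, partialConcat_succ]
  induction n with
  | zero => simp [partialConcat_zero]
  | succ n ih => rw [partialConcat_succ, ih, aux, mul_add_one]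

lemma IsConcat.unique {q : FreeMonoid A} {u : ℕ → FreeMonoid A} {α β : ℕ → A}
    (hα : IsConcat q u α) (hβ : IsConcat q u β) : α = β := by
  funext i
  obtain ⟨n, hn⟩ := (hα.2.eventually_gt_atTop i).exists
  exact Option.some_injective _ ((hα.1 n i hn).symm.trans (hβ.1 n i hn))

lemma exists_isConcat (q : FreeMonoid A) (u : ℕ → FreeMonoid A)
    (h : Tendsto (fun n => (partialConcat q u n).length) atTop atTop) :
    ∃ α, IsConcat q u α := by
  have pre : ∀ n k, (partialConcat q u n).toList <+: (partialConcat q u (n + k)).toList := by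
    intro n k
    induction k with
    | zero => exact List.prefix_rfl
    | succ k ih =>
      refine ih.trans ?_
      rw [← add_assoc, partialConcat_succ, FreeMonoid.toList_mul]
      exact List.prefix_append _ _
  choose N hN using fun i => (h.eventually_gt_atTop i).exists
  refine ⟨fun i => (partialConcat q u (N i)).toList[i]'(hN i), fun n i hi => ?_, h⟩
  rw [← List.getElem?_eq_getElem (hN i)]
  rcases le_total n (N i) with hle | hle <;> obtain ⟨k, hk⟩ := Nat.exists_eq_add_of_le hle
  · rw [hk]
    rw [List.prefix_iff_getElem?.1 (pre n k) i hi]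
    exact List.getElem?_eq_getElem hi
  · rw [hk]
    rw [List.prefix_iff_getElem?.1 (pre (N i) k) i (hN i)]
    exact (List.getElem?_eq_getElem (hN i)).symm

lemma tendsto_length_partialConcat (q : FreeMonoid A) {u : ℕ → FreeMonoid A}
    (hu : ∀ n, u n ≠ 1) :
    Tendsto (fun n => (partialConcat q u n).length) atTop atTop := by
  refine tendsto_atTop_mono (fun n => ?_) tendsto_id
  induction n with
  | zero => simp
  | succ n ih =>
    have : (u n).length ≠ 0 := fun h => hu n (FreeMonoid.length_eq_zero.1 h)
    simp only [id, partialConcat_succ, FreeMonoid.length_mul] at ih ⊢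
    omega

lemma length_list_prod (L : List (FreeMonoid A)) :
    L.prod.length = (L.map FreeMonoid.length).sum := by
  induction L with
  | nil => simp
  | cons a L ih => simp [FreeMonoid.length_mul, ih]

lemma length_pow (r : FreeMonoid A) (n : ℕ) : (r ^ n).length = n * r.length := by
  induction n with
  | zero => simp
  | succ n ih => rw [pow_succ, FreeMonoid.length_mul, ih, add_one_mul]

lemma iterate_of (h : FreeMonoid B →* FreeMonoid B) {c : B} {x : FreeMonoid B}
    (hx : h (FreeMonoid.of c) = FreeMonoid.of c * x) (n : ℕ) :
    h^[n] (FreeMonoid.of c) = partialConcat (FreeMonoid.of c) (fun k => h^[k] x) n := by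
  induction n with
  | zero => simp [partialConcat_zero]
  | succ n ih =>
    rw [Function.iterate_succ_apply, hx, iterate_map_mul, ih, partialConcat_succ]

lemma iterate_list_prod (h : FreeMonoid B →* FreeMonoid B) (n : ℕ) (L : List (FreeMonoid B)) :
    h^[n] L.prod = (L.map h^[n]).prod := by
  induction L with
  | nil => simp [iterate_map_one]
  | cons a L ih => simp [iterate_map_mul, ih]

end Concat

/-! ### Growth of the number of occurrences of a set of letters -/

section Growth

variable {B : Type*}

open Classical in
/-- The morphism that erases all letters outside `S`. The number of occurrences in `w` of letters
of `S` is `(proj S w).length`. -/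
noncomputable def proj (S : Set B) : FreeMonoid B →* FreeMonoid B :=
  FreeMonoid.lift fun b => if b ∈ S then FreeMonoid.of b else 1

lemma proj_of_mem {S : Set B} {b : B} (hb : b ∈ S) : proj S (.of b) = .of b := by
  simp [proj, hb]

lemma proj_of_notMem {S : Set B} {b : B} (hb : b ∉ S) : proj S (.of b) = 1 := by
  simp [proj, hb]

lemma length_proj_le (S : Set B) (w : FreeMonoid B) : (proj S w).length ≤ w.length := by
  induction w using FreeMonoid.inductionOn' with
  | one => simp
  | of_mul b w ih =>
    by_cases hb : b ∈ S <;>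
      simp only [map_mul, FreeMonoid.length_mul, proj_of_mem, proj_of_notMem, hb,
        not_false_eq_true, FreeMonoid.length_one, FreeMonoid.length_of] <;> omega

open Classical in
lemma toList_proj (S : Set B) (w : FreeMonoid B) :
    (proj S w).toList = w.toList.filter (· ∈ S) := by
  induction w using FreeMonoid.inductionOn' with
  | one => simp
  | of_mul b w ih =>
    by_cases hb : b ∈ S <;> simp [proj_of_mem, proj_of_notMem, hb, ih]

lemma proj_eq_one_iff {S : Set B} {w : FreeMonoid B} :
    proj S w = 1 ↔ ∀ b ∈ w.toList, b ∉ S := by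
  classical
  rw [← FreeMonoid.toList.injective.eq_iff, toList_proj]
  simp

/-- The image under `h` of a letter of `S` has a letter in `S`, that of any other letter has
none. -/
structure Persistent (h : FreeMonoid B →* FreeMonoid B) (S : Set B) : Prop where
  ne_one : ∀ b ∈ S, proj S (h (.of b)) ≠ 1
  eq_one : ∀ b ∉ S, proj S (h (.of b)) = 1

namespace Persistent

variable {h : FreeMonoid B →* FreeMonoid B} {S : Set B}

lemma length_le_map (hS : Persistent h S) (w : FreeMonoid B) :
    (proj S w).length ≤ (proj S (h w)).length := by
  induction w using FreeMonoid.inductionOn' with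
  | one => simp
  | of_mul b w ih =>
    simp only [map_mul, FreeMonoid.length_mul]
    refine add_le_add ?_ ih
    by_cases hb : b ∈ S
    · rw [proj_of_mem hb, FreeMonoid.length_of, Nat.one_le_iff_ne_zero]
      exact fun h0 => hS.ne_one b hb (FreeMonoid.length_eq_zero.1 h0)
    · simp [proj_of_notMem hb]

lemma monotone_length (hS : Persistent h S) (w : FreeMonoid B) :
    Monotone fun n => (proj S (h^[n] w)).length :=
  monotone_nat_of_le_succ fun n => by
    rw [Function.iterate_succ_apply']
    exact hS.length_le_map _

lemma proj_map_proj (hS : Persistent h S) (w : FreeMonoid B) :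
    proj S (h (proj S w)) = proj S (h w) := by
  induction w using FreeMonoid.inductionOn' with
  | one => simp
  | of_mul b w ih =>
    by_cases hb : b ∈ S <;>
      simp [proj_of_mem, proj_of_notMem, hb, ih, hS.eq_one]

lemma proj_iterate_congr (hS : Persistent h S) {v w : FreeMonoid B} (hvw : proj S v = proj S w)
    (n : ℕ) : proj S (h^[n] v) = proj S (h^[n] w) := by
  induction n with
  | zero => simpa
  | succ n ih =>
    rw [Function.iterate_succ_apply', Function.iterate_succ_apply', ← hS.proj_map_proj, ih,
      hS.proj_map_proj]

lemma proj_iterate_eq_one (hS : Persistent h S) {w : FreeMonoid B} (hw : proj S w = 1)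
    (n : ℕ) : proj S (h^[n] w) = 1 := by
  have := hS.proj_iterate_congr (v := w) (w := 1) (by simpa) n
  simpa [iterate_map_one] using this

lemma of_eq_iterate (hS : Persistent h S) {H : FreeMonoid B →* FreeMonoid B} {n : ℕ}
    (hH : ⇑H = h^[n]) : Persistent H S where
  ne_one b hb h1 := by
    rw [hH] at h1
    have := hS.monotone_length (.of b) (Nat.zero_le n)
    simp [h1, proj_of_mem hb] at this
  eq_one b hb := by
    rw [hH]
    exact hS.proj_iterate_eq_one (proj_of_notMem hb) n

/-- The occurrences of a persistent set of letters in the iterates on a word are either bounded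
in number or grow at least linearly: after a fixed number `K` of steps, every letter of `S` that
ever branches has done so; if the number of occurrences is unchanged over `K` steps, none of
them ever branches. -/
theorem exists_bounded_or_linear [Finite B] (hS : Persistent h S) :
    ∃ K, 0 < K ∧ ∀ w, (∃ C, ∀ n, (proj S (h^[n] w)).length ≤ C) ∨
      ∀ n, n ≤ (proj S (h^[K * n] w)).length := by
  have key : ∀ b, ∃ k, (∀ j, (proj S (h^[j] (.of b))).length ≤ (proj S (.of b)).length) ∨
      (proj S (.of b)).length < (proj S (h^[k] (.of b))).length := by
    intro b
    by_cases hb : ∀ j, (proj S (h^[j] (.of b))).length ≤ (proj S (.of b)).length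
    · exact ⟨0, .inl hb⟩
    · push Not at hb
      exact hb.imp fun _ => .inr
  choose k hk using key
  obtain ⟨M, hM⟩ := (Set.finite_range k).bddAbove
  have hM : ∀ b, k b ≤ M := fun b => hM ⟨b, rfl⟩
  have still : ∀ w, (proj S (h^[M + 1] w)).length ≤ (proj S w).length →
      ∀ j, (proj S (h^[j] w)).length ≤ (proj S w).length := by
    intro w hw j
    induction w using FreeMonoid.inductionOn' with
    | one => simp [iterate_map_one]
    | of_mul b w ih =>
      simp only [iterate_map_mul, map_mul, FreeMonoid.length_mul] at hw ih ⊢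
      have h1 : (proj S (.of b)).length ≤ _ := hS.monotone_length (.of b) (Nat.zero_le (M + 1))
      have h2 : (proj S w).length ≤ _ := hS.monotone_length w (Nat.zero_le (M + 1))
      have h3 := hS.monotone_length (.of b) ((hM b).trans (Nat.le_succ M))
      simp only [Nat.succ_eq_add_one] at h1 h2 h3
      refine add_le_add ((hk b).resolve_right (by omega) j) (ih (by omega))
  refine ⟨M + 1, M.succ_pos, fun w => ?_⟩
  by_cases hw : ∃ n, (proj S (h^[M + 1] (h^[n] w))).length ≤ (proj S (h^[n] w)).length
  · obtain ⟨n, hn⟩ := hw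
    refine .inl ⟨(proj S (h^[n] w)).length, fun j =>
      (hS.monotone_length w (Nat.le_add_right j n)).trans ?_⟩
    simp only [Function.iterate_add_apply]
    exact still _ hn j
  · push Not at hw
    refine .inr fun n => ?_
    induction n with
    | zero => simp
    | succ n ih =>
      have := hw ((M + 1) * n)
      rw [← Function.iterate_add_apply, add_comm (M + 1), ← mul_add_one] at this
      omega

end Persistent

/-- A letter is bounded for `h` if the lengths of its iterates are bounded. -/
def IsBounded (h : FreeMonoid B →* FreeMonoid B) (b : B) : Prop :=
  ∃ C, ∀ n, (h^[n] (.of b)).length ≤ C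

variable {h : FreeMonoid B →* FreeMonoid B}

lemma exists_length_le_of_letters {w : FreeMonoid B} (hw : ∀ b ∈ w.toList, IsBounded h b) :
    ∃ C, ∀ n, (h^[n] w).length ≤ C := by
  induction w using FreeMonoid.inductionOn' with
  | one => exact ⟨0, by simp [iterate_map_one]⟩
  | of_mul b w ih =>
    simp only [FreeMonoid.toList_of_mul, List.mem_cons, forall_eq_or_imp] at hw
    obtain ⟨C, hC⟩ := hw.1
    obtain ⟨D, hD⟩ := ih hw.2
    refine ⟨C + D, fun n => ?_⟩
    rw [iterate_map_mul, FreeMonoid.length_mul]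
    exact add_le_add (hC n) (hD n)

lemma length_iterate_of_le {w : FreeMonoid B} {b : B} (hb : b ∈ w.toList) (n : ℕ) :
    (h^[n] (.of b)).length ≤ (h^[n] w).length := by
  induction w using FreeMonoid.inductionOn' with
  | one => simp at hb
  | of_mul c w ih =>
    rw [FreeMonoid.toList_of_mul, List.mem_cons] at hb
    rw [iterate_map_mul, FreeMonoid.length_mul]
    rcases hb with rfl | hb
    · omega
    · exact (ih hb).trans (Nat.le_add_left _ _)

lemma persistent_unbounded (h : FreeMonoid B →* FreeMonoid B) :
    Persistent h {b | ¬ IsBounded h b} where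
  ne_one b hb h1 := by
    rw [proj_eq_one_iff] at h1
    obtain ⟨C, hC⟩ := exists_length_le_of_letters fun b hb => not_not.1 (h1 b hb)
    refine hb ⟨C + 1, fun n => ?_⟩
    cases n with
    | zero => simp
    | succ n => exact (hC n).trans (Nat.le_succ C)
  eq_one b hb := by
    obtain ⟨C, hC⟩ := not_not.1 hb
    rw [proj_eq_one_iff]
    exact fun d hd => not_not.2 ⟨C, fun n => (length_iterate_of_le hd n).trans (hC (n + 1))⟩

lemma IsMortal.exists_iterate_eq_one {w : FreeMonoid B} (hw : ∀ b ∈ w.toList, IsMortal h (.of b)) :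
    ∃ m, ∀ n, m ≤ n → h^[n] w = 1 := by
  induction w using FreeMonoid.inductionOn' with
  | one => exact ⟨0, by simp [iterate_map_one]⟩
  | of_mul b w ih =>
    simp only [FreeMonoid.toList_of_mul, List.mem_cons, forall_eq_or_imp] at hw
    obtain ⟨C, hC⟩ := hw.1
    obtain ⟨D, hD⟩ := ih hw.2
    refine ⟨C + D, fun n hn => ?_⟩
    obtain ⟨k, rfl⟩ := Nat.exists_eq_add_of_le (show C ≤ n by omega)
    rw [iterate_map_mul, hD _ (by omega), add_comm, Function.iterate_add_apply, hC,
      iterate_map_one, one_mul]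

lemma persistent_immortal (h : FreeMonoid B →* FreeMonoid B) :
    Persistent h {b | ¬ IsMortal h (.of b)} where
  ne_one b hb h1 := by
    rw [proj_eq_one_iff] at h1
    obtain ⟨m, hm⟩ := IsMortal.exists_iterate_eq_one fun b hb => not_not.1 (h1 b hb)
    exact hb ⟨m + 1, hm m le_rfl⟩
  eq_one b hb := by
    obtain ⟨m, hm⟩ := not_not.1 hb
    rw [proj_eq_one_iff]
    refine fun d hd => not_not.2 ⟨m, FreeMonoid.length_eq_zero.1 <| Nat.eq_zero_of_le_zero ?_⟩
    refine (length_iterate_of_le hd m).trans ?_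
    rw [← Function.iterate_succ_apply, Function.iterate_succ_apply', hm]
    simp

/-- A word with boundedly many immortal letters in its iterates has bounded iterates: the mortal
letters die within a fixed number of steps. -/
lemma exists_length_le_of_immortal [Finite B] {w : FreeMonoid B} {C : ℕ}
    (hC : ∀ n, (proj {b | ¬ IsMortal h (.of b)} (h^[n] w)).length ≤ C) :
    ∃ D, ∀ n, (h^[n] w).length ≤ D := by
  have hT : ∀ b, ∃ m, IsMortal h (.of b) → ∀ n, m ≤ n → h^[n] (.of b) = 1 := by
    intro b
    by_cases hb : IsMortal h (.of b)
    · obtain ⟨m, hm⟩ := IsMortal.exists_iterate_eq_one (h := h) (w := .of b) (by simpa)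
      exact ⟨m, fun _ => hm⟩
    · exact ⟨0, fun h => absurd h hb⟩
  choose m hm using hT
  obtain ⟨T, hT⟩ := (Set.finite_range m).bddAbove
  obtain ⟨L, hL⟩ := (Set.finite_range fun b => (h^[T] (.of b)).length).bddAbove
  have key : ∀ v, (h^[T] v).length ≤ (proj {b | ¬ IsMortal h (.of b)} v).length * L := by
    intro v
    induction v using FreeMonoid.inductionOn' with
    | one => simp [iterate_map_one]
    | of_mul b v ih =>
      rw [iterate_map_mul, map_mul, FreeMonoid.length_mul, FreeMonoid.length_mul, add_mul]
      refine add_le_add ?_ ih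
      by_cases hb : IsMortal h (.of b)
      · simp [hm b hb T (hT ⟨b, rfl⟩)]
      · rw [proj_of_mem (by exact hb), FreeMonoid.length_of, one_mul]
        exact hL ⟨b, rfl⟩
  obtain ⟨E, hE⟩ := (Set.finite_range fun n : Fin T => (h^[n] w).length).bddAbove
  refine ⟨max E (C * L), fun n => ?_⟩
  rcases lt_or_ge n T with hn | hn
  · exact le_max_of_le_left (hE ⟨⟨n, hn⟩, rfl⟩)
  · obtain ⟨k, rfl⟩ := Nat.exists_eq_add_of_le hn
    rw [Function.iterate_add_apply]
    exact le_max_of_le_right ((key _).trans (Nat.mul_le_mul_right L (hC k)))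

lemma exists_linear_lower_bound [Finite B] (h : FreeMonoid B →* FreeMonoid B) :
    ∃ K, 0 < K ∧ ∀ b, ¬ IsBounded h b → ∀ n t, K * n ≤ t → n ≤ (h^[t] (.of b)).length := by
  obtain ⟨K, hK, H⟩ := (persistent_immortal h).exists_bounded_or_linear
  refine ⟨K, hK, fun b hb n t ht => ?_⟩
  rcases H (.of b) with ⟨C, hC⟩ | hlin
  · exact absurd (exists_length_le_of_immortal hC) hb
  · exact (hlin n).trans (((persistent_immortal h).monotone_length _ ht).trans
      (length_proj_le _ _))

/-- If the total length of the first `n` iterates on `x` is `O(n²)`, then the iterates have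
boundedly many unbounded letters: otherwise the number of these grows at least linearly, and so
does the length of the iterates on each of them, so the total length grows at least cubically. -/
theorem exists_length_proj_unbounded_le [Finite B] {x : FreeMonoid B} {C : ℕ}
    (hC : ∀ n, 0 < n → (partialConcat 1 (fun k => h^[k] x) n).length ≤ C * n ^ 2) :
    ∃ D, ∀ n, (proj {b | ¬ IsBounded h b} (h^[n] x)).length ≤ D := by
  obtain ⟨K, hK, H⟩ := (persistent_unbounded h).exists_bounded_or_linear
  refine (H x).resolve_right fun hlin => ?_
  obtain ⟨K', hK', H'⟩ := exists_linear_lower_bound h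
  have mul_le : ∀ n t, K' * n ≤ t → ∀ w,
      (proj {b | ¬ IsBounded h b} w).length * n ≤ (h^[t] w).length := by
    intro n t ht w
    induction w using FreeMonoid.inductionOn' with
    | one => simp
    | of_mul b w ih =>
      rw [iterate_map_mul, map_mul, FreeMonoid.length_mul, FreeMonoid.length_mul, add_mul]
      refine add_le_add ?_ ih
      by_cases hb : IsBounded h b
      · simp [proj_of_notMem (S := {b | ¬ IsBounded h b}) (b := b) (by simpa)]
      · rw [proj_of_mem (by exact hb), FreeMonoid.length_of, one_mul]
        exact H' b hb n t ht
  have sq_le : ∀ n k, (K + K') * n ≤ k → n * n ≤ (h^[k] x).length := by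
    intro n k hk
    obtain ⟨t, rfl⟩ := Nat.exists_eq_add_of_le
      ((Nat.mul_le_mul_right n (Nat.le_add_right K K')).trans hk)
    rw [add_comm, Function.iterate_add_apply]
    refine (Nat.mul_le_mul_right n (hlin n)).trans (mul_le n t ?_ _)
    rw [add_mul] at hk
    omega
  have cube_le : ∀ n j, j * (n * n) ≤
      (partialConcat 1 (fun k => h^[k] x) ((K + K') * n + j)).length := by
    intro n j
    induction j with
    | zero => simp
    | succ j ih =>
      rw [← add_assoc, partialConcat_succ, FreeMonoid.length_mul, add_one_mul]
      exact add_le_add ih (sq_le _ _ (Nat.le_add_right _ _))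
  -- With `j = n` and `L = K + K' + 1` the bounds read `n³ ≤ C L² n²`, which fails for large `n`.
  set n := C * (K + K' + 1) ^ 2 + 1 with hn
  have h1 := cube_le n n
  have h2 := hC ((K + K') * n + n) (by omega)
  have h3 : n * (n * n) ≤ (C * (K + K' + 1) ^ 2) * (n * n) := by
    calc _ ≤ _ := h1.trans h2
      _ = _ := by ring
  have h4 := Nat.le_of_mul_le_mul_right h3 (by positivity)
  omega

end Growth

/-! ### Products of powers with linear exponents -/

section Linear

variable {A B : Type*}

/-- The sequence of strings `s` is a product of powers `r ^ (a * n + b)` of nonempty strings, in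
which no exponent vanishes identically. The list holds the triples `(r, a, b)`; it may be
empty. -/
def IsLinearProd (s : ℕ → FreeMonoid A) : Prop :=
  ∃ L : List (FreeMonoid A × ℕ × ℕ), (∀ t ∈ L, t.1 ≠ 1 ∧ 0 < t.2.1 + t.2.2) ∧
    ∀ n, s n = (L.map fun t => t.1 ^ (t.2.1 * n + t.2.2)).prod

lemma IsLinearProd.mul {s t : ℕ → FreeMonoid A} (hs : IsLinearProd s) (ht : IsLinearProd t) :
    IsLinearProd fun n => s n * t n := by
  obtain ⟨L, hL, hs⟩ := hs
  obtain ⟨M, hM, ht⟩ := ht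
  refine ⟨L ++ M, fun u hu => ?_, fun n => by simp [hs, ht]⟩
  exact (List.mem_append.1 hu).elim (hL u) (hM u)

lemma isLinearProd_pow (r : FreeMonoid A) (a b : ℕ) :
    IsLinearProd fun n => r ^ (a * n + b) := by
  by_cases h : r ≠ 1 ∧ 0 < a + b
  · exact ⟨[(r, a, b)], by simpa using h, by simp⟩
  · refine ⟨[], by simp, fun n => ?_⟩
    rcases not_and_or.1 h with h | h
    · simp [not_not.1 h]
    · obtain ⟨rfl, rfl⟩ : a = 0 ∧ b = 0 := by omega
      simp

lemma isLinearProd_const (r : FreeMonoid A) : IsLinearProd fun _ => r := by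
  simpa using isLinearProd_pow r 0 1

lemma IsLinearProd.map_of_letters {g : ℕ → FreeMonoid B →* FreeMonoid A} {w : FreeMonoid B}
    (h : ∀ b ∈ w.toList, IsLinearProd fun n => g n (.of b)) : IsLinearProd fun n => g n w := by
  induction w using FreeMonoid.inductionOn' with
  | one => simpa using isLinearProd_const 1
  | of_mul b w ih =>
    simp only [FreeMonoid.toList_of_mul, List.mem_cons, forall_eq_or_imp] at h
    simpa only [map_mul] using h.1.mul (ih h.2)

lemma IsLinearProd.isMultilinear {s : ℕ → FreeMonoid A} (hs : IsLinearProd s) {q : FreeMonoid A}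
    {α : ℕ → A} (hα : IsConcat q s α) : IsMultilinear α := by
  obtain ⟨L, hL, hs⟩ := hs
  refine ⟨q, L.length, fun i => (L.get i).1, fun i => (L.get i).2.1, fun i => (L.get i).2.2,
    ?_, fun i => (hL _ (L.get_mem i)).1, fun i => (hL _ (L.get_mem i)).2, ?_⟩
  · rw [List.length_pos_iff]
    rintro rfl
    -- All factors would be empty, against the unboundedness of the partial concatenations.
    have : ∀ n, partialConcat q s n = q := by
      intro n
      induction n with
      | zero => exact partialConcat_zero q s
      | succ n ih => simp [partialConcat_succ, ih, hs]
    have h2 := hα.2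
    simp only [this] at h2
    exact not_tendsto_const_atTop _ _ h2
  · convert hα using 2 with n
    rw [hs]
    conv_rhs => rw [← List.ofFn_get L, List.map_ofFn]
    rfl

end Linear

/-! ### From morphic words of quadratic growth to multilinear words -/

section Morphic

variable {A B : Type*} {h : FreeMonoid B →* FreeMonoid B}

/-- The `n`-th iterate of a morphism, as a morphism. -/
def iterateHom (h : FreeMonoid B →* FreeMonoid B) (n : ℕ) : FreeMonoid B →* FreeMonoid B where
  toFun := h^[n]
  map_one' := iterate_map_one h n
  map_mul' := iterate_map_mul h n

lemma finite_setOf_length_le [Finite B] (C : ℕ) : {w : FreeMonoid B | w.length ≤ C}.Finite :=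
  List.finite_length_le B C

/-- After passing to a suitable power `h ^ p`, the images of bounded letters are fixed, and so are
the unbounded letters of the iterates on `x`: both sequences are determined by recursion and take
finitely many values. -/
lemma exists_period [Finite B] {x : FreeMonoid B} {D : ℕ}
    (hD : ∀ n, (proj {b | ¬ IsBounded h b} (h^[n] x)).length ≤ D) :
    ∃ p, 0 < p ∧ (∀ b, IsBounded h b → h^[p] (h^[p] (.of b)) = h^[p] (.of b)) ∧
      ∀ n, p ≤ n → proj {b | ¬ IsBounded h b} (h^[n + p] x) =
        proj {b | ¬ IsBounded h b} (h^[n] x) := by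
  let F : ℕ → ({b // IsBounded h b} → FreeMonoid B) × FreeMonoid B := fun n =>
    (fun b => h^[n] (.of b), proj {b | ¬ IsBounded h b} (h^[n] x))
  choose C hC using fun b : {b // IsBounded h b} => b.2
  let T : Set (({b // IsBounded h b} → FreeMonoid B) × FreeMonoid B) :=
    (Set.univ.pi fun b => {w : FreeMonoid B | w.length ≤ C b}) ×ˢ {w : FreeMonoid B | w.length ≤ D}
  have hfin : T.Finite :=
    (Set.Finite.pi fun b => finite_setOf_length_le (C b)).prod (finite_setOf_length_le D)
  have hmem : ∀ n, F n ∈ T := fun n => Set.mem_prod.2 ⟨fun b _ => hC b n, hD n⟩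
  obtain ⟨i, j, hij, hF⟩ := hfin.exists_lt_map_eq_of_forall_mem hmem
  obtain ⟨d, rfl⟩ := Nat.exists_eq_add_of_lt hij
  have step : ∀ k, F (i + k + (d + 1)) = F (i + k) := by
    intro k
    obtain ⟨h1, h2⟩ := Prod.mk.inj hF
    refine Prod.ext (funext fun b => ?_) ?_
    · have := congrArg h^[k] (congrFun h1 b)
      rw [← Function.iterate_add_apply, ← Function.iterate_add_apply] at this
      simp only [F]
      rw [show i + k + (d + 1) = k + (i + d + 1) by omega, add_comm i k]
      exact this.symm
    · have := (persistent_unbounded h).proj_iterate_congr h2 k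
      rw [← Function.iterate_add_apply, ← Function.iterate_add_apply] at this
      simp only [F]
      rw [show i + k + (d + 1) = k + (i + d + 1) by omega, add_comm i k]
      exact this.symm
  have steps : ∀ m n, i ≤ n → F (n + m * (d + 1)) = F n := by
    intro m n hn
    obtain ⟨k, rfl⟩ := Nat.exists_eq_add_of_le hn
    induction m with
    | zero => simp
    | succ m ih =>
      rw [add_one_mul, ← add_assoc, add_assoc i, step, ← add_assoc, ih]
  have hp : i ≤ (i + 1) * (d + 1) := by nlinarith
  refine ⟨(i + 1) * (d + 1), by positivity, fun b hb => ?_, fun n hn => ?_⟩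
  · rw [← Function.iterate_add_apply]
    exact congrFun (congrArg Prod.fst (steps (i + 1) _ hp)) ⟨b, hb⟩
  · exact congrArg Prod.snd (steps (i + 1) n (hp.trans hn))

/-- If the unbounded letters of `w` and `h w` agree, then each of them produces exactly one
unbounded letter, namely itself. -/
lemma Persistent.proj_map_eq_of_mem {S : Set B} (hS : Persistent h S) {w : FreeMonoid B}
    (hw : proj S (h w) = proj S w) {b : B} (hb : b ∈ w.toList) (hbS : b ∈ S) :
    proj S (h (.of b)) = .of b := by
  induction w using FreeMonoid.inductionOn' with
  | one => simp at hb
  | of_mul c w ih =>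
    -- The images of `c` and of `w` have at least as many letters in `S`, hence exactly as many.
    have h1 := hS.length_le_map (.of c)
    have h2 := hS.length_le_map w
    have h3 := congrArg FreeMonoid.length hw
    simp only [map_mul, FreeMonoid.length_mul] at h3
    have hw' : (proj S (h (.of c))).toList ++ (proj S (h w)).toList =
        (proj S (.of c)).toList ++ (proj S w).toList := by
      simpa only [map_mul, FreeMonoid.toList_mul] using congrArg FreeMonoid.toList hw
    obtain ⟨hc, hw''⟩ := List.append_inj hw' (show (proj S _).length = (proj S _).length by omega)
    rcases List.mem_cons.1 hb with rfl | hb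
    · rw [proj_of_mem hbS] at hc
      exact hc
    · exact ih hw'' hb

/-- A letter that reproduces itself once, all other letters being fixed after one step, has
iterates `v ^ n * z * w ^ n`. -/
lemma isLinearProd_iterate_letter {S : Set B} {b : B} (hb : b ∈ S → proj S (h (.of b)) = .of b)
    (hfix : ∀ w, proj S w = 1 → h (h w) = h w) (τ : B → A) :
    IsLinearProd fun n => FreeMonoid.map τ (h^[n + 1] (.of b)) := by
  classical
  by_cases hbS : b ∈ S
  · have hl := congrArg FreeMonoid.toList (hb hbS)
    rw [toList_proj, FreeMonoid.toList_of, List.filter_eq_cons_iff] at hl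
    obtain ⟨l, l', hl, hv, -, hw⟩ := hl
    obtain ⟨v, rfl⟩ := FreeMonoid.toList.surjective l
    obtain ⟨w, rfl⟩ := FreeMonoid.toList.surjective l'
    have hl : h (.of b) = v * .of b * w :=
      FreeMonoid.toList.injective (by simpa using hl)
    have hv : h (h v) = h v := hfix v (proj_eq_one_iff.2 (by simpa using hv))
    have hw : h (h w) = h w := hfix w (proj_eq_one_iff.2 (by simpa using hw))
    have key : ∀ n, h^[n + 1] (.of b) = h v ^ n * h (.of b) * h w ^ n := by
      intro n
      induction n with
      | zero => simp
      | succ n ih =>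
        rw [Function.iterate_succ_apply', ih, map_mul, map_mul, map_pow, map_pow, hv, hw,
          hl, map_mul, map_mul, hl, pow_succ, pow_succ']
        simp only [mul_assoc]
    simp only [key, map_mul, map_pow]
    have hlin : ∀ r : FreeMonoid A, IsLinearProd fun n => r ^ n := fun r => by
      simpa using isLinearProd_pow r 1 0
    exact ((hlin _).mul (isLinearProd_const _)).mul (hlin _)
  · have key : ∀ n, h^[n + 1] (.of b) = h (.of b) := by
      intro n
      induction n with
      | zero => rfl
      | succ n ih => rw [Function.iterate_succ_apply', ih, hfix _ (proj_of_notMem hbS)]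
    simp only [key]
    exact isLinearProd_const _

lemma iterate_partialConcat (h : FreeMonoid B →* FreeMonoid B) (q : FreeMonoid B)
    (u : ℕ → FreeMonoid B) (k n : ℕ) :
    h^[k] (partialConcat q u n) = partialConcat (h^[k] q) (fun j => h^[k] (u j)) n := by
  induction n with
  | zero => simp [partialConcat_zero]
  | succ n ih => rw [partialConcat_succ, partialConcat_succ, iterate_map_mul, ih]

theorem isMultilinear_of_quadratic [Finite B] {x : FreeMonoid B} {q : FreeMonoid B} {β : ℕ → B}
    (hβ : IsConcat q (fun n => h^[n] x) β) {C : ℕ}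
    (hC : ∀ n, 0 < n → (partialConcat 1 (fun k => h^[k] x) n).length ≤ C * n ^ 2) (τ : B → A) :
    IsMultilinear (τ ∘ β) := by
  obtain ⟨D, hD⟩ := exists_length_proj_unbounded_le hC
  obtain ⟨p, hp, hbdd, hunb⟩ := exists_period hD
  set U := {b | ¬ IsBounded h b}
  obtain ⟨H, hH⟩ : ∃ H : FreeMonoid B →* FreeMonoid B, ⇑H = h^[p] := ⟨iterateHom h p, rfl⟩
  have hHU : Persistent H U := (persistent_unbounded h).of_eq_iterate hH
  -- Grouping `p` factors at a time turns the product into `y (H y) (H² y) ⋯`.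
  set y := partialConcat 1 (fun j => h^[j] x) p with hy
  have hgroup : ∀ n, partialConcat 1 (fun j => h^[p * n + j] x) p = H^[n] y := by
    intro n
    rw [hH, ← Function.iterate_mul, hy, iterate_partialConcat, iterate_map_one]
    simp only [Function.iterate_add_apply]
  have h1 : IsConcat q (fun n => H^[n] y) β := by
    simpa only [hgroup] using hβ.group hp
  have hproj : ∀ q : FreeMonoid B, ∀ u v : ℕ → FreeMonoid B, (∀ j, proj U (u j) = proj U (v j)) →
      ∀ n, proj U (partialConcat q u n) = proj U (partialConcat q v n) := by
    intro q u v huv n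
    induction n with
    | zero => simp [partialConcat_zero]
    | succ n ih => rw [partialConcat_succ, partialConcat_succ, map_mul, map_mul, ih, huv]
  have hstable : proj U (H (H y)) = proj U (H y) := by
    have e1 := hgroup 1
    have e2 := hgroup 2
    simp only [Function.iterate_succ_apply, Function.iterate_zero_apply] at e1 e2
    rw [← e2, ← e1]
    refine hproj _ _ _ (fun j => ?_) p
    rw [← hunb (p * 1 + j) (by omega), show p * 1 + j + p = p * 2 + j by ring]
  have hfix : ∀ w, proj U w = 1 → H (H w) = H w := by
    intro w hw
    rw [proj_eq_one_iff] at hw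
    induction w using FreeMonoid.inductionOn' with
    | one => simp
    | of_mul b w ih =>
      simp only [FreeMonoid.toList_of_mul, List.mem_cons, forall_eq_or_imp] at hw
      rw [map_mul, map_mul, ih hw.2, hH, hbdd b (not_not.1 hw.1)]
  have hlin : IsLinearProd fun n => FreeMonoid.map τ (H^[n + 1] (H y)) := by
    refine IsLinearProd.map_of_letters (w := H y)
      (g := fun n => (FreeMonoid.map τ).comp (iterateHom H (n + 1))) fun b hb => ?_
    exact isLinearProd_iterate_letter
      (fun hbU => hHU.proj_map_eq_of_mem hstable hb hbU) hfix τ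
  refine hlin.isMultilinear ((h1.map τ).shift 2)

end Morphic

/-! ### From multilinear words to morphic words of quadratic growth -/

section Construction

variable {A : Type*}

lemma of_mul_pow_mul (s t : FreeMonoid A) (k : ℕ) : s * (t * s) ^ k * t = (s * t) ^ (k + 1) := by
  induction k with
  | zero => simp
  | succ k ih =>
    rw [pow_succ', pow_succ', ← ih]
    simp only [mul_assoc]

/-- A multilinear word has a presentation with a nonempty prefix and positive constant terms
in all exponents: drop the first two blocks into the prefix. -/
lemma IsMultilinear.exists_pos {α : ℕ → A} (hα : IsMultilinear α) :
    ∃ (q : FreeMonoid A) (m : ℕ) (r : Fin m → FreeMonoid A) (a b : Fin m → ℕ),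
      q ≠ 1 ∧ 0 < m ∧ (∀ i, r i ≠ 1) ∧ (∀ i, 0 < b i) ∧
        IsConcat q (fun n : ℕ => (List.ofFn fun i : Fin m => r i ^ (a i * n + b i)).prod) α := by
  obtain ⟨q, m, r, a, b, hm, hr, hab, hα⟩ := hα
  have hpos : ∀ i, 0 < a i * 1 + b i := fun i => by simpa using hab i
  refine ⟨partialConcat q (fun n => (List.ofFn fun i : Fin m => r i ^ (a i * n + b i)).prod) 2,
    m, r, a, fun i => a i * 2 + b i, ?_, hm, hr, fun i => ?_, ?_⟩
  · intro h
    have := congrArg FreeMonoid.length h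
    rw [partialConcat_succ, FreeMonoid.length_mul, length_list_prod, List.map_ofFn,
      List.sum_ofFn, FreeMonoid.length_one] at this
    have h0 := (Finset.sum_eq_zero_iff.1 (Nat.eq_zero_of_add_eq_zero_left this)) ⟨0, hm⟩
      (Finset.mem_univ _)
    simp only [Function.comp_apply, length_pow, mul_eq_zero, FreeMonoid.length_eq_zero, hr,
      or_false] at h0
    exact (hpos _).ne' h0
  · have := hab i
    show 0 < a i * 2 + b i
    omega
  · convert hα.shift 2 using 6 with n i
    ring

/-- The letters of the morphism generating a multilinear word: the starting letter `none`, an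
erased and a fixed copy of each of the `k` letters, and a growing letter for each of the `m`
powers. -/
abbrev GenLetter (k m : ℕ) : Type := Option (Fin k ⊕ Fin k ⊕ Fin m)

namespace GenLetter

variable {k m : ℕ}

/-- The erased copy of a letter. -/
def erased (j : Fin k) : GenLetter k m := some (.inl j)

/-- The fixed copy of a letter. -/
def fixed (j : Fin k) : GenLetter k m := some (.inr (.inl j))

/-- The growing letter for the `i`-th power. -/
def growing (i : Fin m) : GenLetter k m := some (.inr (.inr i))

/-- The morphism that maps the starting letter `c` to `c x`, erases the erased letters, fixes the
fixed letters and appends the string `w i` to the `i`-th growing letter. -/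
def morphism (x : FreeMonoid (GenLetter k m)) (w : Fin m → FreeMonoid (GenLetter k m)) :
    FreeMonoid (GenLetter k m) →* FreeMonoid (GenLetter k m) :=
  FreeMonoid.lift fun
    | none => .of none * x
    | some (.inl _) => 1
    | some (.inr (.inl j)) => .of (fixed j)
    | some (.inr (.inr i)) => .of (growing i) * w i

/-- The coding that sends the starting letter to `d`, the copies of `j` to `e j` and the
`i`-th growing letter to `s i`. -/
def coding (e : Fin k → A) (d : A) (s : Fin m → A) : GenLetter k m → A
  | none => d
  | some (.inl j) => e j
  | some (.inr (.inl j)) => e j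
  | some (.inr (.inr i)) => s i

end GenLetter

open GenLetter

lemma exists_morphic_of_presentation [Finite A] {α : ℕ → A} {d : A} {q : FreeMonoid A} {m : ℕ}
    {s : Fin m → A} {t : Fin m → FreeMonoid A} {a b : Fin m → ℕ} (hm : 0 < m)
    (hα : IsConcat (.of d * q)
      (fun n : ℕ =>
        (List.ofFn fun i : Fin m => (.of (s i) * t i) ^ (a i * n + (b i + 1))).prod) α) :
    ∃ f : ℕ → ℕ, IsMorphicWithGrowth α f ∧
        (fun n : ℕ => (f n : ℝ)) =O[atTop] (fun n : ℕ => (n : ℝ) ^ 2) := by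
  obtain ⟨k, ⟨e⟩⟩ := Finite.exists_equiv_fin A
  set u : ℕ → FreeMonoid A :=
    fun n => (List.ofFn fun i : Fin m => (.of (s i) * t i) ^ (a i * n + (b i + 1))).prod with hu
  let fix : FreeMonoid A →* FreeMonoid (GenLetter k m) := FreeMonoid.map fun j => fixed (e j)
  let era : FreeMonoid A →* FreeMonoid (GenLetter k m) := FreeMonoid.map fun j => erased (e j)
  let y : Fin m → FreeMonoid (GenLetter k m) := fun i =>
    .of (growing i) * fix (t i) * fix (.of (s i) * t i) ^ b i
  let x : FreeMonoid (GenLetter k m) := era q * (List.ofFn y).prod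
  -- The string appended to a growing letter is a conjugate of the power it stands for.
  let h := morphism x fun i => fix (t i * .of (s i)) ^ a i
  let τ : GenLetter k m → A := coding e.symm d s
  have hfix : ∀ w, h (fix w) = fix w := fun w => by
    induction w using FreeMonoid.inductionOn' with
    | one => simp
    | of_mul c w ih => rw [map_mul, map_mul, ih]; rfl
  have hera : ∀ w, h (era w) = 1 := fun w => by
    induction w using FreeMonoid.inductionOn' with
    | one => simp
    | of_mul c w ih => rw [map_mul, map_mul, ih]; rfl
  have τfix : ∀ w, FreeMonoid.map τ (fix w) = w := fun w => by
    induction w using FreeMonoid.inductionOn' with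
    | one => simp
    | of_mul c w ih =>
      rw [map_mul, map_mul, ih]
      simp [fix, τ, fixed, coding]
  have τera : ∀ w, FreeMonoid.map τ (era w) = w := fun w => by
    induction w using FreeMonoid.inductionOn' with
    | one => simp
    | of_mul c w ih =>
      rw [map_mul, map_mul, ih]
      simp [era, τ, erased, coding]
  have hfixn : ∀ n w, h^[n] (fix w) = fix w := fun n w =>
    Function.iterate_fixed (hfix w) n
  have hgrow : ∀ n i, h^[n] (.of (growing i)) =
      .of (growing i) * fix (t i * .of (s i)) ^ (a i * n) := by
    intro n i
    induction n with
    | zero => simp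
    | succ n ih =>
      rw [Function.iterate_succ_apply', ih, map_mul, map_pow, hfix, mul_add_one, add_comm, pow_add,
        ← mul_assoc]
      rfl
  have hy : ∀ n i, FreeMonoid.map τ (h^[n] (y i)) =
      (.of (s i) * t i) ^ (a i * n + (b i + 1)) := by
    intro n i
    have τgrow : FreeMonoid.map τ (.of (growing i)) = .of (s i) := rfl
    simp only [y]
    rw [iterate_map_mul, iterate_map_mul, iterate_map_pow, hgrow, hfixn, hfixn]
    simp only [map_mul, map_pow, τfix, τgrow]
    rw [of_mul_pow_mul, ← pow_add]
    congr 1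
    ring
  have hys : ∀ n, FreeMonoid.map τ (h^[n] (List.ofFn y).prod) = u n := by
    intro n
    rw [iterate_list_prod, map_list_prod, List.map_map, List.map_ofFn]
    simp only [hu, ← hy]
    rfl
  have hx0 : FreeMonoid.map τ x = q * u 0 := by
    have := hys 0
    simp only [Function.iterate_zero, id] at this
    simp only [x, map_mul, τera, this]
  have hx : ∀ n, FreeMonoid.map τ (h^[n + 1] x) = u (n + 1) := by
    intro n
    rw [← hys, Function.iterate_succ_apply, Function.iterate_succ_apply]
    simp only [x, map_mul, hera, one_mul]
  have hlen : ∀ n, (u n).length = ∑ i, (a i * n + (b i + 1)) * ((t i).length + 1) := by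
    intro n
    simp only [hu, length_list_prod, List.map_ofFn, List.sum_ofFn, Function.comp_apply,
      length_pow, FreeMonoid.length_mul, FreeMonoid.length_of, add_comm 1]
  have hc : h (.of none) = .of none * x := rfl
  have hmort : ¬ IsMortal h x := by
    rintro ⟨n, hn⟩
    have h1 := hlen (n + 1)
    rw [← hx, Function.iterate_succ_apply', hn, map_one, map_one, FreeMonoid.length_one] at h1
    have h2 := Finset.sum_eq_zero_iff.1 h1.symm ⟨0, hm⟩ (Finset.mem_univ _)
    simp at h2
  obtain ⟨β, hβ⟩ := exists_isConcat (.of none) (fun n => h^[n] x)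
    (tendsto_length_partialConcat _ fun n hn => hmort ⟨n, hn⟩)
  have hαβ : α = τ ∘ β := by
    have h1 := hα.shift 1
    have h2 := (hβ.map τ).shift 1
    simp only [partialConcat_succ, partialConcat_zero, Function.iterate_zero, id, hx0, hx] at h1 h2
    refine h1.unique ?_
    rw [mul_assoc]
    exact h2
  refine ⟨_, ⟨GenLetter k m, inferInstance, h, τ, none, ⟨x, hc, hmort⟩, ⟨β, ⟨x, hc, hβ⟩, hαβ⟩,
    fun n => rfl⟩, ?_⟩
  -- Each factor has length at most `C (n + 1)`, where `C` also accounts for `q`.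
  set C := q.length + ∑ i, (a i + b i + 1) * ((t i).length + 1) with hC
  have hxlen : ∀ n, (h^[n] x).length ≤ C * (n + 1) := by
    intro n
    have hun : (u n).length ≤ (∑ i, (a i + b i + 1) * ((t i).length + 1)) * (n + 1) := by
      rw [hlen, Finset.sum_mul]
      refine Finset.sum_le_sum fun i _ => ?_
      rw [mul_right_comm]
      refine Nat.mul_le_mul_right _ ?_
      nlinarith
    have : (h^[n] x).length ≤ q.length + (u n).length := by
      rw [← length_map τ]
      cases n with
      | zero => simp [hx0, FreeMonoid.length_mul]
      | succ n => exact (congrArg FreeMonoid.length (hx n)).trans_le (Nat.le_add_left _ _)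
    rw [hC, add_mul]
    nlinarith
  have hf : ∀ n, (h^[n] (.of none)).length ≤ 1 + C * n ^ 2 + C * n := by
    intro n
    rw [iterate_of h hc]
    induction n with
    | zero => simp [partialConcat_zero]
    | succ n ih =>
      rw [partialConcat_succ, FreeMonoid.length_mul]
      have := hxlen n
      nlinarith
  refine IsBigO.of_bound (1 + 2 * C) ?_
  filter_upwards [eventually_ge_atTop 1] with n hn
  have h1 := hf n
  have h2 : (h^[n] (.of none)).length ≤ (1 + 2 * C) * n ^ 2 := by nlinarith
  rw [Real.norm_of_nonneg (by positivity), Real.norm_of_nonneg (by positivity)]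
  exact_mod_cast h2

lemma IsMultilinear.exists_morphic [Finite A] {α : ℕ → A} (hα : IsMultilinear α) :
    ∃ f : ℕ → ℕ, IsMorphicWithGrowth α f ∧
        (fun n : ℕ => (f n : ℝ)) =O[atTop] (fun n : ℕ => (n : ℝ) ^ 2) := by
  have hcons : ∀ w : FreeMonoid A, w ≠ 1 → ∃ d v, w = .of d * v := fun w hw => by
    induction w using FreeMonoid.inductionOn' with
    | one => exact absurd rfl hw
    | of_mul d v _ => exact ⟨d, v, rfl⟩
  obtain ⟨q, m, r, a, b, hq, hm, hr, hb, hα⟩ := hα.exists_pos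
  obtain ⟨d, q, rfl⟩ := hcons q hq
  choose s t hst using fun i => hcons (r i) (hr i)
  refine exists_morphic_of_presentation (q := q) (d := d) (s := s) (t := t) (a := a)
    (b := fun i => b i - 1) hm ?_
  simpa only [← hst, Nat.sub_add_cancel (hb _)] using hα

end Construction

lemma IsMorphicWithGrowth.isMultilinear {A : Type*} {α : ℕ → A} {f : ℕ → ℕ}
    (hα : IsMorphicWithGrowth α f)
    (hf : (fun n : ℕ => (f n : ℝ)) =O[atTop] (fun n : ℕ => (n : ℝ) ^ 2)) : IsMultilinear α := by
  obtain ⟨B, _, h, τ, c, -, ⟨β, ⟨x, hx, hβ⟩, rfl⟩, hfn⟩ := hα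
  -- An `O` bound between sequences holds, with some constant, for all `n > 0`.
  rw [← Nat.cofinite_eq_atTop] at hf
  obtain ⟨C, -, hC⟩ := bound_of_isBigO_cofinite hf
  refine isMultilinear_of_quadratic hβ (C := ⌈C⌉₊) (fun n hn => ?_) τ
  have h1 := hC (x := n) (by positivity)
  rw [Real.norm_of_nonneg (by positivity), Real.norm_of_nonneg (by positivity)] at h1
  have h2 : f n ≤ ⌈C⌉₊ * n ^ 2 := by
    have : (f n : ℝ) ≤ ⌈C⌉₊ * (n : ℝ) ^ 2 :=
      h1.trans (mul_le_mul_of_nonneg_right (Nat.le_ceil C) (by positivity))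
    exact_mod_cast this
  refine le_trans ?_ h2
  rw [← hfn, iterate_of h hx, partialConcat, partialConcat, FreeMonoid.length_mul,
    FreeMonoid.length_mul]
  simp

end MorphicWords

theorem theorem5 {A : Type*} [Finite A] (α : ℕ → A) :
    (∃ f : ℕ → ℕ, MorphicWords.IsMorphicWithGrowth α f ∧
        (fun n : ℕ => (f n : ℝ)) =O[atTop] (fun n : ℕ => (n : ℝ) ^ 2)) ↔
      MorphicWords.IsMultilinear α :=
  ⟨fun ⟨_, hα, hf⟩ => hα.isMultilinear hf, fun hα => hα.exists_morphic⟩
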